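/- Let $n \ge 1$. Functions on $\mathbb{R}^n$ that agree almost everywhere are identified. For $f \in L^1(\mathbb{R}^n)$ put $f^*(x) = \overline{f(-x)}$ and $\hat f(\xi) = \int_{\mathbb{R}^n} f(x)\, e^{-i\langle x,\xi\rangle}\,dx$, and for $\varphi \in L^\infty(\mathbb{R}^n)$ (complex valued) let $$\mathrm{sp}(\varphi) = \{\xi \in \mathbb{R}^n : \hat f(\xi) = 0 \text{ for all } f \in L^1(\mathbb{R}^n) \text{ with } f^* * \varphi = 0\},$$ $$P\varphi(x_1,\dots,x_n) = \int_0^{x_1} \varphi(t,x_2,\dots,x_n)\,dt .$$ **Theorem 5.3.** Let $\varphi \in L^\infty(\mathbb{R}^n)$ with $0 \notin \mathrm{sp}(\varphi)$, and suppose that $P\varphi$ is uniformly continuous on $\mathbb{R}^n$ (that is, it agrees almost everywhere with a uniformly continuous function $\psi : \mathbb{R}^n \to \mathbb{C}$). Then $P\varphi$ is bounded (that is, $\psi$ is bounded on $\mathbb{R}^n$ and, with the same bound, $P\varphi$ is bounded almost everywhere). -/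

import Mathlib

open MeasureTheory
open scoped Convolution ENNReal

namespace BeurlingSpectrum

noncomputable section

/-- The involution `f^*(x) = conj (f (-x))` on functions on `ℝⁿ`. -/
def conjReflect {n : ℕ} (f : EuclideanSpace ℝ (Fin n) → ℂ) (x : EuclideanSpace ℝ (Fin n)) : ℂ :=
  (starRingEnd ℂ) (f (-x))

/-- The Fourier transform `f^(ξ) = ∫ f(x) e^{-i⟨x, ξ⟩} dx`; the dual group of `ℝⁿ` is identified
with `ℝⁿ` through the characters `x ↦ e^{i⟨x, ξ⟩}`. -/
def fourierL1 {n : ℕ} (f : EuclideanSpace ℝ (Fin n) → ℂ) (ξ : EuclideanSpace ℝ (Fin n)) : ℂ :=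
  ∫ x, f x * Complex.exp (-(Complex.I * ((inner ℝ x ξ : ℝ) : ℂ)))

/-- The functions `f ∈ L¹(ℝⁿ)` whose convolution `f^* * φ` vanishes (almost everywhere). -/
def annihilator {n : ℕ} (φ : EuclideanSpace ℝ (Fin n) → ℂ) :
    Set (EuclideanSpace ℝ (Fin n) → ℂ) :=
  {f | Integrable f ∧ (conjReflect f ⋆[ContinuousLinearMap.mul ℂ ℂ, volume] φ) =ᵐ[volume] 0}

/-- The Beurling spectrum `sp(φ)`: the common zeros of the Fourier transforms of all functions
in the annihilator of `φ`. -/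
def sp {n : ℕ} (φ : EuclideanSpace ℝ (Fin n) → ℂ) : Set (EuclideanSpace ℝ (Fin n)) :=
  {ξ | ∀ f ∈ annihilator φ, fourierL1 f ξ = 0}

/-- The indefinite integral in the first variable,
`Pφ(x₁, …, xₙ) = ∫_0^{x₁} φ(t, x₂, …, xₙ) dt`. -/
def indefIntegral {n : ℕ} [NeZero n] (φ : EuclideanSpace ℝ (Fin n) → ℂ)
    (x : EuclideanSpace ℝ (Fin n)) : ℂ :=
  ∫ t in (0 : ℝ)..(x 0), φ (WithLp.toLp 2 (Function.update (fun i => x i) 0 t))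

end

end BeurlingSpectrum

open Filter Topology FourierTransform

/-! Since `0` is outside the spectrum, some `g ∈ L¹` with `∫ g = 1` satisfies `g ⋆ φ = 0`. A
Schwartz kernel `k` can replace `g` (`exists_integral_eq_one_convolution_eq_zero`): if the transform
of `k` lives close enough to `0`, then `k ⋆ φ` is a fixed point of an `L¹` contraction and vanishes.

A uniformly continuous `ψ` has increments of at most linear growth, and `k` has a finite first
moment, so `ψ - k ⋆ ψ` is bounded by some `B` (`norm_sub_convolution_le`). Increments of `ψ` along
the first axis are line integrals of `φ`, which `k` kills, so `k ⋆ ψ` is constant along that axis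
(`convolution_eq_of_indefIntegral_ae_eq`). On the hyperplane `x 0 = 0`, `ψ` vanishes, so `‖k ⋆ ψ‖ ≤
B` there, hence everywhere, and `‖ψ‖ ≤ 2B`. -/

namespace BeurlingSpectrum

/-! ### Band-limited kernels and their dilates -/

section Kernels

variable {E : Type*} [NormedAddCommGroup E] [InnerProductSpace ℝ E] [FiniteDimensional ℝ E]
  [MeasurableSpace E] [BorelSpace E]

/-- Translation is continuous in `L¹`. -/
theorem continuous_integral_norm_comp_sub_sub {V : E → ℂ} (hV : Integrable V) :
    Continuous fun y : E => ∫ x, ‖V (x - y) - V x‖ := by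
  have hm : MemLp V 1 volume := memLp_one_iff_integrable.2 hV
  have : Fact ((1 : ℝ≥0∞) ≠ ∞) := ⟨ENNReal.one_ne_top⟩
  let c : C(E, C(E, E)) := (ContinuousMap.mk fun p : E × E => p.2 - p.1).curry
  have hp (y : E) : MeasurePreserving (c y) := measurePreserving_sub_right volume y
  have h1 : Continuous fun y : E => Lp.compMeasurePreserving (c y) (hp y) (hm.toLp V) :=
    continuous_const.compMeasurePreservingLp c.continuous hp ENNReal.one_ne_top
  refine (h1.sub (continuous_const : Continuous fun _ : E => hm.toLp V)).norm.congr fun y => ?_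
  rw [Pi.sub_apply, Lp.toLp_compMeasurePreserving, ← MemLp.toLp_sub, L1.norm_eq_integral_norm]
  refine integral_congr_ae ?_
  filter_upwards [MemLp.coeFn_toLp ((hm.comp_measurePreserving (hp y)).sub hm)] with x hx
  rw [hx]
  rfl

theorem integral_norm_comp_sub_sub_le {V : E → ℂ} (hV : Integrable V) (y : E) :
    ∫ x, ‖V (x - y) - V x‖ ≤ 2 * ∫ x, ‖V x‖ := by
  calc ∫ x, ‖V (x - y) - V x‖ ≤ ∫ x, (‖V (x - y)‖ + ‖V x‖) :=
        integral_mono ((hV.comp_sub_right y).sub hV).norm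
          ((hV.comp_sub_right y).norm.add hV.norm) fun x => norm_sub_le _ _
    _ = 2 * ∫ x, ‖V x‖ := by
        rw [integral_add (hV.comp_sub_right y).norm hV.norm,
          integral_sub_right_eq_self (fun x => ‖V x‖) y]
        ring

theorem tendsto_integral_mul_integral_norm_comp_sub_sub {g V : E → ℂ} (hg : Integrable g)
    (hV : Integrable V) :
    Tendsto (fun r : ℝ => ∫ y, ‖g y‖ * ∫ x, ‖V (x - r • y) - V x‖) (𝓝 0) (𝓝 0) := by
  have hω := continuous_integral_norm_comp_sub_sub hV
  have h0 : (0 : ℝ) = ∫ y : E, ‖g y‖ * ∫ x, ‖V (x - (0 : ℝ) • y) - V x‖ := by simp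
  conv => rhs; rw [h0]
  refine tendsto_integral_filter_of_dominated_convergence
    (fun y => ‖g y‖ * (2 * ∫ x, ‖V x‖)) (Eventually.of_forall fun r => ?_)
    (Eventually.of_forall fun r => Eventually.of_forall fun y => ?_) (hg.norm.mul_const _)
    (Eventually.of_forall fun y => ?_)
  · exact hg.1.norm.mul (hω.comp (continuous_const_smul r)).aestronglyMeasurable
  · rw [Real.norm_of_nonneg (by positivity)]
    gcongr
    exact integral_norm_comp_sub_sub_le hV _
  · have : Continuous fun r : ℝ => ‖g y‖ * ∫ x, ‖V (x - r • y) - V x‖ :=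
      continuous_const.mul (hω.comp (continuous_id.smul continuous_const))
    exact this.tendsto 0

variable (E) in
/-- There are Schwartz functions `k`, `V` with `k ⋆ V = k` and `∫ k = 1`. -/
theorem exists_schwartz_convolution_eq_self : ∃ k V : SchwartzMap E ℂ,
    (⇑k ⋆[ContinuousLinearMap.mul ℂ ℂ, volume] ⇑V) = ⇑k ∧ ∫ x, k x = 1 := by
  -- `b₂ = 1` on the support of `b₁`, so `b₁ b₂ = b₁`; the inverse Fourier transform turns this into
  -- `k ⋆ V = k`.
  let b₁ : ContDiffBump (0 : E) := ⟨1, 2, one_pos, one_lt_two⟩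
  let b₂ : ContDiffBump (0 : E) := ⟨2, 3, two_pos, by norm_num⟩
  have hs (b : ContDiffBump (0 : E)) : HasCompactSupport fun x => (b x : ℂ) :=
    b.hasCompactSupport.comp_left (g := ((↑) : ℝ → ℂ)) rfl
  have hd (b : ContDiffBump (0 : E)) : ContDiff ℝ ((⊤ : ℕ∞) : WithTop ℕ∞) fun x => (b x : ℂ) :=
    Complex.ofRealCLM.contDiff.comp b.contDiff
  let B₁ : SchwartzMap E ℂ := (hs b₁).toSchwartzMap (hd b₁)
  let B₂ : SchwartzMap E ℂ := (hs b₂).toSchwartzMap (hd b₂)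
  have hB : SchwartzMap.pairing (ContinuousLinearMap.mul ℂ ℂ) B₁ B₂ = B₁ := by
    ext x
    rw [SchwartzMap.pairing_apply_apply]
    change (b₁ x : ℂ) * (b₂ x : ℂ) = b₁ x
    by_cases hx : dist x 0 < 2
    · rw [b₂.one_of_mem_closedBall (Metric.mem_closedBall.2 hx.le)]
      simp
    · rw [b₁.zero_of_le_dist (not_lt.1 hx)]
      simp
  refine ⟨𝓕⁻ B₁, 𝓕⁻ B₂, ?_, ?_⟩
  · ext x
    rw [← SchwartzMap.convolution_apply]
    have h : SchwartzMap.convolution (ContinuousLinearMap.mul ℂ ℂ) (𝓕⁻ B₁) (𝓕⁻ B₂) = 𝓕⁻ B₁ := by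
      rw [← FourierTransform.fourierInv_fourier_eq (F := SchwartzMap E ℂ)
        (SchwartzMap.convolution (ContinuousLinearMap.mul ℂ ℂ) (𝓕⁻ B₁) (𝓕⁻ B₂)), SchwartzMap.fourier_convolution, FourierTransform.fourier_fourierInv_eq,
        FourierTransform.fourier_fourierInv_eq, hB]
    rw [h]
  · have h : 𝓕 (𝓕⁻ B₁) 0 = B₁ 0 := by rw [FourierTransform.fourier_fourierInv_eq]
    have h1 : B₁ 0 = 1 := by
      change (b₁ 0 : ℂ) = 1
      rw [b₁.one_of_mem_closedBall (by simp [b₁])]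
      simp
    rw [h1, SchwartzMap.fourier_coe, Real.fourier_eq] at h
    simpa using h

/-- The dilate `x ↦ r ^ d * f (r • x)` of `f`, where `d` is the dimension of the space. -/
noncomputable def dilate (r : ℝ) (f : E → ℂ) (x : E) : ℂ :=
  ((r ^ Module.finrank ℝ E : ℝ) : ℂ) * f (r • x)

theorem integral_dilate {r : ℝ} (hr : 0 < r) (f : E → ℂ) : ∫ x, dilate r f x = ∫ x, f x := by
  have h : ((r ^ Module.finrank ℝ E : ℝ) : ℂ) ≠ 0 := by
    exact_mod_cast (pow_pos hr _).ne'
  simp only [dilate]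
  rw [integral_const_mul, Measure.integral_comp_smul_of_nonneg volume f r (hR := hr.le),
    Complex.real_smul, ← mul_assoc, Complex.ofReal_inv, mul_inv_cancel₀ h, one_mul]

theorem integral_norm_dilate_sub {r : ℝ} (hr : 0 < r) (f : E → ℂ) (y : E) :
    ∫ x, ‖dilate r f (x - y) - dilate r f x‖ = ∫ x, ‖f (x - r • y) - f x‖ := by
  have h : (r ^ Module.finrank ℝ E : ℝ) ≠ 0 := (pow_pos hr _).ne'
  have h2 (x : E) : ‖dilate r f (x - y) - dilate r f x‖ =
      (r ^ Module.finrank ℝ E : ℝ) * (fun z => ‖f (z - r • y) - f z‖) (r • x) := by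
    simp only [dilate, smul_sub]
    rw [← mul_sub, norm_mul, Complex.norm_of_nonneg (by positivity)]
  rw [integral_congr_ae (Eventually.of_forall h2), integral_const_mul,
    Measure.integral_comp_smul_of_nonneg volume (fun z => ‖f (z - r • y) - f z‖) r (hR := hr.le),
    smul_eq_mul, mul_inv_cancel_left₀ h]

theorem dilate_convolution_dilate {r : ℝ} (hr : 0 < r) (f g : E → ℂ) :
    (dilate r f ⋆[ContinuousLinearMap.mul ℂ ℂ, volume] dilate r g) =
      dilate r (f ⋆[ContinuousLinearMap.mul ℂ ℂ, volume] g) := by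
  ext x
  simp only [convolution_mul]
  change _ = ((r ^ Module.finrank ℝ E : ℝ) : ℂ) * ∫ t, f t * g (r • x - t)
  rw [← integral_dilate hr fun t => f t * g (r • x - t), ← integral_const_mul]
  congr 1 with t
  simp only [dilate, smul_sub]
  ring

theorem integrable_dilate {r : ℝ} (hr : 0 < r) {f : E → ℂ} (hf : Integrable f) :
    Integrable (dilate r f) :=
  (hf.comp_smul hr.ne').const_mul _

end Kernels

end BeurlingSpectrum

namespace BeurlingSpectrum

/-! ### Convolution of `L¹` with bounded functions -/

section BoundedConvolution

variable {E : Type*} [NormedAddCommGroup E] [InnerProductSpace ℝ E] [FiniteDimensional ℝ E]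
  [MeasurableSpace E] [BorelSpace E] {𝕜 : Type*} [RCLike 𝕜]

theorem convolutionExists_of_bounded {f φ : E → 𝕜} {M : ℝ} (hf : Integrable f)
    (hφ : AEStronglyMeasurable φ) (hM : ∀ x, ‖φ x‖ ≤ M) :
    ConvolutionExists f φ (ContinuousLinearMap.mul 𝕜 𝕜) volume := fun x =>
  hf.mul_bdd (hφ.comp_quasiMeasurePreserving
    (quasiMeasurePreserving_sub_left_of_right_invariant volume x))
    (Eventually.of_forall fun _ => hM _)

theorem norm_convolution_le {f φ : E → 𝕜} {M : ℝ} (hf : Integrable f) (hM : ∀ x, ‖φ x‖ ≤ M)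
    (x : E) : ‖(f ⋆[ContinuousLinearMap.mul 𝕜 𝕜, volume] φ) x‖ ≤ (∫ t, ‖f t‖) * M := by
  rw [← integral_mul_const]
  refine norm_integral_le_of_norm_le (hf.norm.mul_const M) (Eventually.of_forall fun t => ?_)
  simp only [ContinuousLinearMap.mul_apply', norm_mul]
  gcongr
  exact hM _

theorem aestronglyMeasurable_convolution {f φ : E → 𝕜} (hf : AEStronglyMeasurable f)
    (hφ : AEStronglyMeasurable φ) :
    AEStronglyMeasurable (f ⋆[ContinuousLinearMap.mul 𝕜 𝕜, volume] φ) :=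
  (hf.convolution_integrand (ContinuousLinearMap.mul 𝕜 𝕜) hφ).integral_prod_right'

theorem convolution_assoc_of_bounded {f g φ : E → ℂ} {M : ℝ} (hf : Integrable f)
    (hg : Integrable g) (hφ : AEStronglyMeasurable φ) (hM : ∀ x, ‖φ x‖ ≤ M) :
    ((f ⋆[ContinuousLinearMap.mul ℂ ℂ, volume] g) ⋆[ContinuousLinearMap.mul ℂ ℂ, volume] φ) =
      (f ⋆[ContinuousLinearMap.mul ℂ ℂ, volume]
        (g ⋆[ContinuousLinearMap.mul ℂ ℂ, volume] φ)) := by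
  ext x
  have hM' : ∀ x, ‖‖φ x‖‖ ≤ M := by simpa using hM
  exact convolution_assoc _ _ _ _ (fun a b c => by simp [mul_assoc]) hf.1 hg.1 hφ
    (hf.ae_convolution_exists _ hg)
    (Eventually.of_forall (convolutionExists_of_bounded hg.norm hφ.norm hM'))
    (convolutionExists_of_bounded hf.norm (aestronglyMeasurable_convolution hg.1.norm hφ.norm)
      (norm_convolution_le hg.norm hM') x)

theorem convolution_mul_comm (f g : E → 𝕜) :
    (f ⋆[ContinuousLinearMap.mul 𝕜 𝕜, volume] g) =
      (g ⋆[ContinuousLinearMap.mul 𝕜 𝕜, volume] f) := by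
  ext x
  rw [convolution_mul, convolution_mul_swap]
  simp_rw [mul_comm]

/-- As `∫ g = 1`, `V - g ⋆ V` is a `g`-average of the differences `V x - V (x - y)`; Fubini does the
rest. -/
theorem integral_norm_sub_convolution_le {g V : E → ℂ} (hg : Integrable g)
    (hg1 : ∫ x, g x = 1) (hV : Integrable V) :
    ∫ x, ‖V x - (g ⋆[ContinuousLinearMap.mul ℂ ℂ, volume] V) x‖ ≤
      ∫ y, ‖g y‖ * ∫ x, ‖V (x - y) - V x‖ := by
  have hi : Integrable (fun p : E × E => g p.2 * (V (p.1 - p.2) - V p.1))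
      (volume.prod volume) := by
    simp_rw [mul_sub]
    refine (hg.convolution_integrand (ContinuousLinearMap.mul ℂ ℂ) hV).sub ?_
    simpa only [mul_comm] using hV.mul_prod hg
  have hswap := integral_integral_swap (f := fun x y => ‖g y * (V (x - y) - V x)‖) hi.norm
  simp only [norm_mul, integral_const_mul] at hswap
  rw [← hswap]
  have hn : Integrable fun x => ∫ y, ‖g y‖ * ‖V (x - y) - V x‖ := by
    simpa only [norm_mul] using hi.norm.integral_prod_left
  refine integral_mono_ae (hV.sub (hg.integrable_convolution _ hV)).norm hn ?_
  filter_upwards [hg.ae_convolution_exists (ContinuousLinearMap.mul ℂ ℂ) hV] with x hx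
  have h1 : V x - (g ⋆[ContinuousLinearMap.mul ℂ ℂ, volume] V) x =
      -∫ y, g y * (V (x - y) - V x) := by
    have hx' : Integrable fun y => g y * V (x - y) := hx
    simp_rw [mul_sub]
    rw [integral_sub hx' (hg.mul_const _), integral_mul_const, hg1, convolution_mul]
    ring
  rw [h1, norm_neg]
  refine (norm_integral_le_integral_norm _).trans_eq ?_
  simp_rw [norm_mul]

/-- Iterating the fixed-point equation gives `‖Φ‖ ≤ ‖u‖₁ ^ n * M` for every `n`. -/
theorem eq_zero_of_convolution_eq_self {u Φ : E → ℂ} {M : ℝ} (hu : Integrable u)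
    (hu1 : ∫ x, ‖u x‖ < 1) (hM : ∀ x, ‖Φ x‖ ≤ M)
    (h : (u ⋆[ContinuousLinearMap.mul ℂ ℂ, volume] Φ) = Φ) : Φ = 0 := by
  have hn (n : ℕ) : ∀ x, ‖Φ x‖ ≤ (∫ x, ‖u x‖) ^ n * M := by
    induction n with
    | zero => simpa using hM
    | succ n ih =>
      intro x
      rw [← h, pow_succ', mul_assoc]
      exact norm_convolution_le hu ih x
  ext x
  have ht : Tendsto (fun n : ℕ => (∫ x, ‖u x‖) ^ n * M) atTop (𝓝 (0 * M)) :=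
    (tendsto_pow_atTop_nhds_zero_of_lt_one (by positivity) hu1).mul_const M
  rw [zero_mul] at ht
  exact norm_le_zero_iff.1 (ge_of_tendsto' ht fun n => hn n x)

/-- If a bounded `φ` is annihilated by some `g ∈ L¹` with `∫ g = 1`, then `g` can be replaced by a
kernel with a finite first moment. -/
theorem exists_integral_eq_one_convolution_eq_zero {g φ : E → ℂ} {M : ℝ} (hg : Integrable g)
    (hg1 : ∫ x, g x = 1) (hφ : AEStronglyMeasurable φ) (hM : ∀ x, ‖φ x‖ ≤ M)
    (h : (g ⋆[ContinuousLinearMap.mul ℂ ℂ, volume] φ) =ᵐ[volume] 0) :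
    ∃ k : E → ℂ, Integrable k ∧ Integrable (fun x => ‖x‖ * ‖k x‖) ∧ ∫ x, k x = 1 ∧
      (k ⋆[ContinuousLinearMap.mul ℂ ℂ, volume] φ) = 0 := by
  obtain ⟨k, V, hkV, hk1⟩ := exists_schwartz_convolution_eq_self E
  -- For small `r`, the dilate `V_r` satisfies `‖V_r - g ⋆ V_r‖₁ < 1`: dilating `V` amounts to
  -- shrinking the shifts `y` to `r • y`.
  obtain ⟨r, hr1, hr⟩ := (((tendsto_integral_mul_integral_norm_comp_sub_sub hg
    V.integrable).mono_left nhdsWithin_le_nhds).eventually_lt_const one_pos).and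
      (self_mem_nhdsWithin : Set.Ioi (0 : ℝ) ∈ 𝓝[>] 0) |>.exists
  replace hr : 0 < r := hr
  have hk := integrable_dilate hr (k.integrable (μ := volume))
  have hV := integrable_dilate hr (V.integrable (μ := volume))
  refine ⟨dilate r k, hk, ?_, by rw [integral_dilate hr, hk1], ?_⟩
  · have := ((k.integrable_pow_mul volume 1).comp_smul hr.ne').const_mul
      (r ^ Module.finrank ℝ E * r⁻¹)
    refine this.congr (Eventually.of_forall fun x => ?_)
    simp only [dilate, norm_mul, norm_smul, pow_one, Complex.norm_real, norm_pow,
      Real.norm_of_nonneg hr.le]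
    field_simp
  have hΦ : AEStronglyMeasurable (dilate r k ⋆[ContinuousLinearMap.mul ℂ ℂ, volume] φ) :=
    aestronglyMeasurable_convolution hk.1 hφ
  have hΦM := norm_convolution_le hk hM
  have hgΦ : (g ⋆[ContinuousLinearMap.mul ℂ ℂ, volume]
      (dilate r k ⋆[ContinuousLinearMap.mul ℂ ℂ, volume] φ)) = 0 := by
    rw [← convolution_assoc_of_bounded hg hk hφ hM, convolution_mul_comm g,
      convolution_assoc_of_bounded hk hg hφ hM, convolution_congr _ (ae_eq_refl _) h,
      convolution_zero]
  have hVΦ : (dilate r V ⋆[ContinuousLinearMap.mul ℂ ℂ, volume]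
      (dilate r k ⋆[ContinuousLinearMap.mul ℂ ℂ, volume] φ)) =
      (dilate r k ⋆[ContinuousLinearMap.mul ℂ ℂ, volume] φ) := by
    rw [← convolution_assoc_of_bounded hV hk hφ hM, convolution_mul_comm (dilate r V),
      dilate_convolution_dilate hr, hkV]
  have hgV := hg.integrable_convolution (ContinuousLinearMap.mul ℂ ℂ) hV
  -- With `Φ = k_r ⋆ φ`, both `V_r ⋆ Φ = Φ` and `g ⋆ Φ = 0` hold, so `V_r - g ⋆ V_r` fixes `Φ`.
  refine eq_zero_of_convolution_eq_self (hV.sub hgV) ((integral_norm_sub_convolution_le hg hg1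
    hV).trans_lt ?_) hΦM ?_
  · simp_rw [integral_norm_dilate_sub hr]
    exact hr1
  · generalize (dilate r k ⋆[ContinuousLinearMap.mul ℂ ℂ, volume] φ) = Φ at *
    ext x
    have e1 : Integrable fun t => dilate r V t * Φ (x - t) :=
      convolutionExists_of_bounded hV hΦ hΦM x
    have e2 : Integrable fun t =>
        (g ⋆[ContinuousLinearMap.mul ℂ ℂ, volume] dilate r V) t * Φ (x - t) :=
      convolutionExists_of_bounded hgV hΦ hΦM x
    rw [convolution_mul]
    simp only [Pi.sub_apply, sub_mul]
    rw [integral_sub e1 e2, ← convolution_mul, ← convolution_mul, hVΦ, convolution_mul_comm g,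
      convolution_assoc_of_bounded hV hg hΦ hΦM, hgΦ, convolution_zero]
    simp

end BoundedConvolution

end BeurlingSpectrum

/-! ### Linear growth, bounded representatives, integrals along lines -/

namespace BeurlingSpectrum

/-- A uniformly continuous function on a normed space grows at most linearly. -/
theorem exists_norm_sub_le_of_uniformContinuous {E F : Type*} [NormedAddCommGroup E]
    [NormedSpace ℝ E] [NormedAddCommGroup F] {ψ : E → F} (hψ : UniformContinuous ψ) :
    ∃ C : ℝ, ∀ x y, ‖ψ x - ψ y‖ ≤ C * (1 + ‖x - y‖) := by
  obtain ⟨δ, hδ, h⟩ := Metric.uniformContinuous_iff.1 hψ 1 one_pos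
  refine ⟨1 + 1 / δ, fun x y => ?_⟩
  -- The segment from `y` to `x` splits into `N` steps shorter than `δ`, each changing `ψ` by less
  -- than `1`.
  set N : ℕ := ⌊‖x - y‖ / δ⌋₊ + 1 with hN
  have hN0 : (0 : ℝ) < N := by positivity
  have hlt : ‖x - y‖ / δ < N := by
    rw [hN]
    exact_mod_cast Nat.lt_floor_add_one _
  have hle : (N : ℝ) ≤ ‖x - y‖ / δ + 1 := by
    rw [hN]
    push_cast
    gcongr
    exact Nat.floor_le (by positivity)
  have hstep (i : ℕ) : ‖ψ (y + ((i : ℝ) / N) • (x - y)) - ψ y‖ ≤ i := by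
    induction i with
    | zero => simp
    | succ i ih =>
      have h1 : dist (y + (((i + 1 : ℕ) : ℝ) / N) • (x - y)) (y + ((i : ℝ) / N) • (x - y)) < δ := by
        rw [dist_add_left, dist_eq_norm, ← sub_smul, ← sub_div, norm_smul, Nat.cast_succ,
          add_sub_cancel_left, norm_div, norm_one, Real.norm_of_nonneg hN0.le, one_div_mul_eq_div,
          div_lt_iff₀ hN0]
        rwa [div_lt_iff₀ hδ, mul_comm] at hlt
      have h2 := (h h1).le
      rw [dist_eq_norm] at h2
      calc _ ≤ _ := norm_sub_le_norm_sub_add_norm_sub _ (ψ (y + ((i : ℝ) / N) • (x - y))) _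
        _ ≤ 1 + i := add_le_add h2 ih
        _ = ((i + 1 : ℕ) : ℝ) := by push_cast; ring
  have hfin := hstep N
  rw [div_self hN0.ne', one_smul, add_sub_cancel] at hfin
  refine (hfin.trans hle).trans ?_
  have : (1 + 1 / δ) * (1 + ‖x - y‖) = ‖x - y‖ / δ + 1 + (1 / δ + ‖x - y‖) := by ring
  rw [this]
  exact le_add_of_nonneg_right (by positivity)

theorem exists_bounded_representative {α : Type*} [MeasurableSpace α] {μ : Measure α} {φ : α → ℂ}
    (hφ : MemLp φ ∞ μ) :
    ∃ (φ' : α → ℂ) (M : ℝ), StronglyMeasurable φ' ∧ (∀ x, ‖φ' x‖ ≤ M) ∧ φ =ᵐ[μ] φ' := by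
  let φ₁ := hφ.1.mk φ
  let M := (eLpNorm φ ∞ μ).toReal
  have hm : StronglyMeasurable φ₁ := hφ.1.stronglyMeasurable_mk
  have hs : MeasurableSet {x | ‖φ₁ x‖ ≤ M} := measurableSet_le hm.norm.measurable measurable_const
  refine ⟨Set.indicator {x | ‖φ₁ x‖ ≤ M} φ₁, M, hm.indicator hs, fun x => ?_, ?_⟩
  · by_cases hx : ‖φ₁ x‖ ≤ M
    · rwa [Set.indicator_of_mem (by exact hx)]
    · rw [Set.indicator_of_notMem (by exact hx), norm_zero]
      exact ENNReal.toReal_nonneg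
  · filter_upwards [hφ.1.ae_eq_mk, ae_le_eLpNormEssSup (f := φ) (μ := μ)] with x hx hx'
    have : ‖φ₁ x‖ ≤ M := by
      change ‖hφ.1.mk φ x‖ ≤ M
      rw [← hx]
      have hfin : eLpNorm φ ∞ μ ≠ ∞ := hφ.2.ne
      rw [← eLpNorm_exponent_top] at hx'
      exact ENNReal.toReal_mono hfin hx'
    rw [Set.indicator_of_mem (by exact this)]
    exact hx

section Lines

variable {E : Type*} [NormedAddCommGroup E] [NormedSpace ℝ E] [FiniteDimensional ℝ E]
  [MeasurableSpace E] [BorelSpace E] {μ : Measure E} [μ.IsAddHaarMeasure]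

/-- A property that holds almost everywhere holds almost everywhere on almost every line of a given
direction. -/
theorem ae_ae_add_smul {p : E → Prop} (hp : ∀ᵐ x ∂μ, p x) (e : E) :
    ∀ᵐ x ∂μ, ∀ᵐ s : ℝ, p (x + s • e) := by
  have hq : Measure.QuasiMeasurePreserving (fun z : E × ℝ => z.1 + z.2 • e) (μ.prod volume) μ :=
    QuasiMeasurePreserving.prod_of_left (by fun_prop) (Eventually.of_forall fun s =>
      (measurePreserving_add_right μ (s • e)).quasiMeasurePreserving)
  exact Measure.ae_ae_of_ae_prod (hq.ae hp)

omit [FiniteDimensional ℝ E] in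
theorem intervalIntegrable_add_smul {φ : E → ℂ} {M : ℝ} (hφ : StronglyMeasurable φ)
    (hM : ∀ x, ‖φ x‖ ≤ M) (x e : E) (a b : ℝ) :
    IntervalIntegrable (fun s : ℝ => φ (x + s • e)) volume a b := by
  refine (intervalIntegrable_const (c := M)).mono_fun
    (hφ.comp_measurable (by fun_prop)).aestronglyMeasurable (Eventually.of_forall fun s => ?_)
  exact (hM _).trans (le_abs_self M)

/-- The average of the line integrals of `φ` against `k` is the line integral of `k ⋆ φ`. -/
theorem integral_mul_intervalIntegral_add_smul {k φ : E → ℂ} {M : ℝ} (hk : Integrable k μ)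
    (hφ : StronglyMeasurable φ) (hM : ∀ x, ‖φ x‖ ≤ M) (x e : E) (a b : ℝ) :
    ∫ t, k t * (∫ s in a..b, φ (x - t + s • e)) ∂μ =
      ∫ s in a..b, (k ⋆[ContinuousLinearMap.mul ℂ ℂ, μ] φ) (x + s • e) := by
  have : IsFiniteMeasure (volume.restrict (Set.uIoc a b)) :=
    ⟨by simp [Set.uIoc]⟩
  simp_rw [← intervalIntegral.integral_const_mul]
  rw [← intervalIntegral_integral_swap]
  · simp only [convolution_mul, add_sub_right_comm]
  · refine Integrable.mul_bdd (c := M) ?_ ?_ (Eventually.of_forall fun _ => hM _)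
    · exact hk.comp_snd _
    · exact (hφ.comp_measurable (by fun_prop)).aestronglyMeasurable

end Lines

end BeurlingSpectrum

namespace BeurlingSpectrum

/-! ### The indefinite integral on `ℝⁿ` -/

section Euclidean

variable {n : ℕ}

theorem toLp_update_eq_add_smul [NeZero n] (x : EuclideanSpace ℝ (Fin n)) (t : ℝ) :
    WithLp.toLp 2 (Function.update (fun i => x i) 0 t) =
      x + (t - x 0) • EuclideanSpace.single (0 : Fin n) (1 : ℝ) := by
  ext i
  by_cases hi : i = 0
  · subst hi
    simp
  · simp [hi]

theorem indefIntegral_eq_intervalIntegral [NeZero n] (φ : EuclideanSpace ℝ (Fin n) → ℂ)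
    (x : EuclideanSpace ℝ (Fin n)) :
    indefIntegral φ x =
      ∫ s in (-x 0)..0, φ (x + s • EuclideanSpace.single (0 : Fin n) (1 : ℝ)) := by
  simp only [indefIntegral, toLp_update_eq_add_smul]
  rw [intervalIntegral.integral_comp_sub_right
    (fun s => φ (x + s • EuclideanSpace.single (0 : Fin n) (1 : ℝ)))]
  simp

theorem indefIntegral_congr_ae [NeZero n] {φ φ' : EuclideanSpace ℝ (Fin n) → ℂ}
    (h : φ =ᵐ[volume] φ') : indefIntegral φ =ᵐ[volume] indefIntegral φ' := by
  filter_upwards [ae_ae_add_smul h (EuclideanSpace.single (0 : Fin n) (1 : ℝ))] with x hx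
  rw [indefIntegral_eq_intervalIntegral, indefIntegral_eq_intervalIntegral]
  exact intervalIntegral.integral_congr_ae (hx.mono fun s hs _ => hs)

theorem norm_indefIntegral_le [NeZero n] {φ : EuclideanSpace ℝ (Fin n) → ℂ} {M : ℝ}
    (hM : ∀ x, ‖φ x‖ ≤ M) (x : EuclideanSpace ℝ (Fin n)) : ‖indefIntegral φ x‖ ≤ M * |x 0| := by
  have := intervalIntegral.norm_integral_le_of_norm_le_const (a := 0) (b := x 0)
    (f := fun t => φ (WithLp.toLp 2 (Function.update (fun i => x i) 0 t))) fun t _ => hM _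
  simpa [indefIntegral] using this

theorem indefIntegral_sub_indefIntegral [NeZero n] {φ : EuclideanSpace ℝ (Fin n) → ℂ} {M : ℝ}
    (hφ : StronglyMeasurable φ) (hM : ∀ x, ‖φ x‖ ≤ M) (x : EuclideanSpace ℝ (Fin n)) (a : ℝ) :
    indefIntegral φ x -
        indefIntegral φ (x - a • EuclideanSpace.single (0 : Fin n) (1 : ℝ)) =
      ∫ s in (-a)..0, φ (x + s • EuclideanSpace.single (0 : Fin n) (1 : ℝ)) := by
  rw [indefIntegral_eq_intervalIntegral, indefIntegral_eq_intervalIntegral]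
  set e := EuclideanSpace.single (0 : Fin n) (1 : ℝ) with he
  have h1 (s : ℝ) : x - a • e + s • e = x + (s - a) • e := by module
  simp only [h1]
  rw [intervalIntegral.integral_comp_sub_right (fun s => φ (x + s • e))]
  have h2 : -(x - a • e) 0 - a = -x 0 := by simp [he]
  rw [h2, zero_sub, sub_eq_iff_eq_add',
    intervalIntegral.integral_add_adjacent_intervals
      (intervalIntegrable_add_smul hφ hM x e _ _) (intervalIntegrable_add_smul hφ hM x e _ _)]

/-- If `0` is not in the spectrum of `φ`, then `φ` is annihilated by some `g ∈ L¹` of integral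
one. -/
theorem exists_convolution_ae_eq_zero_of_zero_notMem_sp {φ : EuclideanSpace ℝ (Fin n) → ℂ}
    (h0 : (0 : EuclideanSpace ℝ (Fin n)) ∉ sp φ) :
    ∃ g : EuclideanSpace ℝ (Fin n) → ℂ, Integrable g ∧ ∫ x, g x = 1 ∧
      (g ⋆[ContinuousLinearMap.mul ℂ ℂ, volume] φ) =ᵐ[volume] 0 := by
  simp only [sp, Set.mem_ofPred_eq, not_forall] at h0
  obtain ⟨f, ⟨hf, hfφ⟩, hne⟩ := h0
  -- The transform of `f` at `0` is `∫ f`, whose conjugate is `∫ f^*`.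
  have hc : ∫ x, conjReflect f x ≠ 0 := by
    simp only [conjReflect]
    rw [integral_conj, integral_neg_eq_self f]
    simpa [fourierL1] using hne
  have hi : Integrable (conjReflect f) :=
    Complex.conjCLE.toContinuousLinearMap.integrable_comp hf.comp_neg
  refine ⟨(∫ x, conjReflect f x)⁻¹ • conjReflect f, hi.smul _, ?_, ?_⟩
  · simp only [Pi.smul_apply, smul_eq_mul]
    rw [integral_const_mul]
    exact inv_mul_cancel₀ hc
  · rw [smul_convolution]
    filter_upwards [hfφ] with x hx
    simp [hx]

/-- The bound holds on a set both dense and closed. It makes `ψ` vanish on the null hyperplane `x 0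
= 0`, where almost everywhere equality alone says nothing. -/
theorem norm_le_of_indefIntegral_ae_eq [NeZero n] {φ ψ : EuclideanSpace ℝ (Fin n) → ℂ} {M : ℝ}
    (hM : ∀ x, ‖φ x‖ ≤ M) (hψ : Continuous ψ) (h : indefIntegral φ =ᵐ[volume] ψ)
    (x : EuclideanSpace ℝ (Fin n)) : ‖ψ x‖ ≤ M * |x 0| := by
  have hd : Dense {x | ‖ψ x‖ ≤ M * |x 0|} := Measure.dense_of_ae (μ := volume) (by
    filter_upwards [h] with x hx
    rw [← hx]
    exact norm_indefIntegral_le hM x)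
  have hcl : IsClosed {x : EuclideanSpace ℝ (Fin n) | ‖ψ x‖ ≤ M * |x 0|} :=
    isClosed_le hψ.norm (by fun_prop)
  have := hd x
  rwa [hcl.closure_eq] at this

/-- If `k ⋆ φ = 0`, then `k ⋆ ψ` does not depend on the first coordinate, where `ψ` is the
indefinite integral of `φ`. -/
theorem convolution_eq_of_indefIntegral_ae_eq [NeZero n] {k φ ψ : EuclideanSpace ℝ (Fin n) → ℂ}
    {M : ℝ} (hφ : StronglyMeasurable φ) (hM : ∀ x, ‖φ x‖ ≤ M) (h : indefIntegral φ =ᵐ[volume] ψ)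
    (hk : Integrable k) (hkφ : (k ⋆[ContinuousLinearMap.mul ℂ ℂ, volume] φ) = 0)
    (hkψ : ConvolutionExists k ψ (ContinuousLinearMap.mul ℂ ℂ) volume)
    (x : EuclideanSpace ℝ (Fin n)) (a : ℝ) :
    (k ⋆[ContinuousLinearMap.mul ℂ ℂ, volume] ψ) x =
      (k ⋆[ContinuousLinearMap.mul ℂ ℂ, volume] ψ)
        (x - a • EuclideanSpace.single (0 : Fin n) (1 : ℝ)) := by
  set e := EuclideanSpace.single (0 : Fin n) (1 : ℝ) with he
  have h1 := (quasiMeasurePreserving_sub_left_of_right_invariant volume x).ae h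
  have h2 := (quasiMeasurePreserving_sub_left_of_right_invariant volume (x - a • e)).ae h
  rw [← sub_eq_zero, convolution_def, convolution_def, ← integral_sub (hkψ x) (hkψ _)]
  have h3 := integral_mul_intervalIntegral_add_smul hk hφ hM x e (-a) 0
  rw [hkφ] at h3
  simp only [Pi.zero_apply, intervalIntegral.integral_zero] at h3
  rw [← h3]
  refine integral_congr_ae ?_
  filter_upwards [h1, h2] with t h1 h2
  rw [← indefIntegral_sub_indefIntegral hφ hM, ← h1, ← he, sub_right_comm x t, h2]
  simp only [ContinuousLinearMap.mul_apply', h1]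
  ring

end Euclidean

theorem norm_sub_convolution_le {E : Type*} [NormedAddCommGroup E] [InnerProductSpace ℝ E]
    [FiniteDimensional ℝ E] [MeasurableSpace E] [BorelSpace E] {k ψ : E → ℂ} {C : ℝ}
    (hk : Integrable k) (hk' : Integrable fun x => ‖x‖ * ‖k x‖) (hk1 : ∫ x, k x = 1)
    (hψ : Continuous ψ) (hC : ∀ x y, ‖ψ x - ψ y‖ ≤ C * (1 + ‖x - y‖)) :
    ConvolutionExists k ψ (ContinuousLinearMap.mul ℂ ℂ) volume ∧
      ∀ x, ‖ψ x - (k ⋆[ContinuousLinearMap.mul ℂ ℂ, volume] ψ) x‖ ≤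
        ∫ t, C * (‖k t‖ + ‖t‖ * ‖k t‖) := by
  have hb (x t : E) : ‖k t * (ψ x - ψ (x - t))‖ ≤ C * (‖k t‖ + ‖t‖ * ‖k t‖) := by
    have := hC x (x - t)
    rw [sub_sub_cancel] at this
    rw [norm_mul]
    calc ‖k t‖ * ‖ψ x - ψ (x - t)‖ ≤ ‖k t‖ * (C * (1 + ‖t‖)) := by gcongr
      _ = _ := by ring
  have hbi : Integrable fun t => C * (‖k t‖ + ‖t‖ * ‖k t‖) := (hk.norm.add hk').const_mul C
  have hd (x : E) : Integrable fun t => k t * (ψ x - ψ (x - t)) :=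
    hbi.mono' (hk.1.mul (by fun_prop : Continuous fun t => ψ x - ψ (x - t)).aestronglyMeasurable)
      (Eventually.of_forall (hb x))
  have he (x : E) : Integrable fun t => k t * ψ (x - t) := by
    refine ((hk.mul_const (ψ x)).sub (hd x)).congr (Eventually.of_forall fun t => ?_)
    simp only [Pi.sub_apply]
    ring
  refine ⟨he, fun x => ?_⟩
  have h1 : ψ x - (k ⋆[ContinuousLinearMap.mul ℂ ℂ, volume] ψ) x =
      ∫ t, k t * (ψ x - ψ (x - t)) := by
    simp_rw [mul_sub]
    rw [integral_sub (hk.mul_const _) (he x), integral_mul_const, hk1, one_mul, convolution_mul]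
  rw [h1]
  exact norm_integral_le_of_norm_le hbi (Eventually.of_forall (hb x))

end BeurlingSpectrum

open BeurlingSpectrum in
/-- Functions are identified when they agree almost everywhere: `Pφ` is uniformly continuous if it
agrees almost everywhere with some uniformly continuous `ψ`. The conclusion bounds this `ψ`
everywhere and `Pφ` itself almost everywhere. -/
theorem theorem5p3 {n : ℕ} [NeZero n] (φ : EuclideanSpace ℝ (Fin n) → ℂ)
    (hφ : MemLp φ ∞ volume)
    (h0 : (0 : EuclideanSpace ℝ (Fin n)) ∉ BeurlingSpectrum.sp φ)
    (ψ : EuclideanSpace ℝ (Fin n) → ℂ) (hψ : UniformContinuous ψ)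
    (hPφ : BeurlingSpectrum.indefIntegral φ =ᵐ[volume] ψ) :
    ∃ C : ℝ, (∀ x, ‖ψ x‖ ≤ C) ∧
      ∀ᵐ x ∂(volume : Measure (EuclideanSpace ℝ (Fin n))),
        ‖BeurlingSpectrum.indefIntegral φ x‖ ≤ C := by
  obtain ⟨φ', M, hφ', hM, hφφ'⟩ := exists_bounded_representative hφ
  have hP : indefIntegral φ' =ᵐ[volume] ψ := (indefIntegral_congr_ae hφφ').symm.trans hPφ
  obtain ⟨g, hg, hg1, hgφ⟩ := exists_convolution_ae_eq_zero_of_zero_notMem_sp h0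
  rw [convolution_congr _ (ae_eq_refl g) hφφ'] at hgφ
  obtain ⟨k, hk, hk', hk1, hkφ⟩ := exists_integral_eq_one_convolution_eq_zero hg hg1
    hφ'.aestronglyMeasurable hM hgφ
  obtain ⟨C, hC⟩ := exists_norm_sub_le_of_uniformContinuous hψ
  obtain ⟨hex, hbd⟩ := norm_sub_convolution_le hk hk' hk1 hψ.continuous hC
  set B := ∫ t, C * (‖k t‖ + ‖t‖ * ‖k t‖)
  have hB (x : EuclideanSpace ℝ (Fin n)) : ‖ψ x‖ ≤ B + B := by
    -- `y` is the projection of `x` to the hyperplane `x 0 = 0`.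
    set y := x - x 0 • EuclideanSpace.single (0 : Fin n) (1 : ℝ) with hy
    have hy0 : ψ y = 0 := by
      simpa [hy] using norm_le_of_indefIntegral_ae_eq hM hψ.continuous hP y
    have hxy := convolution_eq_of_indefIntegral_ae_eq hφ' hM hP hk hkφ hex x (x 0)
    rw [← hy] at hxy
    have h1 := hbd y
    rw [← hxy, hy0] at h1
    calc ‖ψ x‖ = ‖(ψ x - (k ⋆[ContinuousLinearMap.mul ℂ ℂ, volume] ψ) x) -
          (0 - (k ⋆[ContinuousLinearMap.mul ℂ ℂ, volume] ψ) x)‖ := by congr 1; ring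
      _ ≤ B + B := (norm_sub_le _ _).trans (add_le_add (hbd x) h1)
  refine ⟨B + B, hB, ?_⟩
  filter_upwards [hPφ] with x hx
  rw [hx]
  exact hB x
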